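/- Let $r,\lambda,\delta,\alpha,x^*>0$ and $y\ge x^*$. Let $0=\tau_0<\tau_1<\tau_2<\dots$, where $\tau_1,\tau_2,\dots$ are the jump times of a Poisson process of intensity $\lambda$, and let $Z_1,Z_2,\dots$ be i.i.d. $\mathrm{Beta}(\alpha,1)$ random variables (distribution function $z^\alpha$ on $(0,1)$), independent of that process. A household's capital $X$ grows between the times $\tau_i$ according to $dX_t=r[X_t-x^*]^+dt$, and at time $\tau_i$ ($i\ge1$) it is multiplied by $Z_i$. Under the strategy with threshold $y$, whenever the capital is at a level $k<y$ (at time $0$, or after a loss) a lump sum $y-k$ is transferred at once, which raises the capital to $y$; there are no other transfers. Let $S_t$ be the total of the transfers up to time $t$ (including one at time $0$), and, for initial capital $x\ge 0$, let $$V_y(x)=\mathbb E\Big[\int_{0^-}^\infty e^{-\delta t}\,dS_t\Big].$$ Put $$a=\frac{-(\delta+\lambda-\alpha r)-\sqrt{(\delta+\lambda-\alpha r)^2+4r\alpha\delta}}{2r},\qquad b=\frac{-(\delta+\lambda-\alpha r)+\sqrt{(\delta+\lambda-\alpha r)^2+4r\alpha\delta}}{2r},\qquad c=\alpha,$$ let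 ${}_2F_1$ be the Gauss hypergeometric function, and $$A(y)=\frac{\lambda y}{(\alpha+1)\left(\frac{x^*}{y}\right)^b\Big[\delta\,{}_2F_1\big(b,b-c+1;b-a+1;\tfrac{x^*}{y}\big)+r(y-x^*)\tfrac{b}{y}\,{}_2F_1\big(b+1,b-c+1;b-a+1;\tfrac{x^*}{y}\big)\Big]},$$ where for $y=x^*$ the second term in the bracket is read as $0$. Then $V_y(x)$ is finite for every $x\ge0$, and $$V_y(x)=\begin{cases}(y-x)+{}_2F_1\big(b,b-c+1;b-a+1;\tfrac{x^*}{y}\big)\,A(y)\,\big(\tfrac{x^*}{y}\big)^b & \text{if } 0\le x\le y,\\[1ex] {}_2F_1\big(b,b-c+1;b-a+1;\tfrac{x^*}{x}\big)\,A(y)\,\big(\tfrac{x^*}{x}\big)^b & \text{if } x>y.\end{cases}$$ -/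

import Mathlib

open MeasureTheory ProbabilityTheory
open scoped ENNReal

namespace SocialProtection

/-- The loss events of the model. `τ n` is the time of the `n`-th loss event, with `τ 0 = 0`
(time `0` is not an event), and `Z n` is the proportion of the capital that remains at the
event `τ (n + 1)`. The events form a Poisson process of intensity `lam`, that is, the waiting
times between consecutive events are independent and exponentially distributed with rate `lam`;
the remaining proportions are independent with common law `G`; and the sequence of proportions is
independent of the sequence of event times. -/
structure IsLossModel {Ω : Type*} [MeasurableSpace Ω] (P : Measure Ω) (lam : ℝ) (G : Measure ℝ)
    (τ Z : ℕ → Ω → ℝ) : Prop where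
  measurable_time : ∀ n, Measurable (τ n)
  measurable_proportion : ∀ n, Measurable (Z n)
  time_zero : ∀ ω, τ 0 ω = 0
  law_wait : ∀ n, P.map (fun ω => τ (n + 1) ω - τ n ω) = expMeasure lam
  indep_wait : iIndepFun (fun (n : ℕ) (ω : Ω) => τ (n + 1) ω - τ n ω) P
  law_proportion : ∀ n, P.map (Z n) = G
  indep_proportion : iIndepFun Z P
  indep_time_proportion : IndepFun (fun ω n => τ n ω) (fun ω n => Z n ω) P

/-- Capital after a time `t` without losses and transfers, started from `k`: the solution of
`dX = r [X - xs]⁺ dt`, `X 0 = k`. -/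
noncomputable def flow (r xs t k : ℝ) : ℝ :=
  if xs < k then (k - xs) * Real.exp (r * t) + xs else k

variable {Ω : Type*}

/-- Capital under the strategy with threshold `y` and initial capital `x`, at the times at which a
transfer can occur, immediately before the transfer: for `n = 0` the initial capital, for
`n + 1` the capital just after the loss at time `τ (n + 1)`. The transfer raises a capital `k` to
`max k y`; from there the capital grows along `flow` until the next loss. As `y ≥ xs`, capital does
not decrease between losses, so that no transfer is due strictly between two events. -/
noncomputable def capitalBefore (r xs y x : ℝ) (τ Z : ℕ → Ω → ℝ) : ℕ → Ω → ℝ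
  | 0, _ => x
  | n + 1, ω =>
      flow r xs (τ (n + 1) ω - τ n ω) (max (capitalBefore r xs y x τ Z n ω) y) * Z n ω

/-- The lump sum transferred at time `τ n` (at time `0` for `n = 0`) by the strategy with threshold
`y`: the shortfall `y - k` of the capital `k` if `k < y`, and nothing otherwise. -/
noncomputable def transfer (r xs y x : ℝ) (τ Z : ℕ → Ω → ℝ) (n : ℕ) (ω : Ω) : ℝ :=
  max (y - capitalBefore r xs y x τ Z n ω) 0

/-- The random measure `dS` of the cumulative transfers `S`, `S t = ∑ {transfer n : τ n ≤ t}`,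
of the strategy with threshold `y`. It includes the mass `S 0` at time `0`. -/
noncomputable def thresholdTransfers (r xs y x : ℝ) (τ Z : ℕ → Ω → ℝ) (ω : Ω) : Measure ℝ :=
  Measure.sum fun n => ENNReal.ofReal (transfer r xs y x τ Z n ω) • Measure.dirac (τ n ω)

/-- Expected discounted transfers `E[∫_{[0,∞)} exp (-δ t) dS t]` of a strategy with random
transfer measure `dS`. -/
noncomputable def expectedCost [MeasurableSpace Ω] (P : Measure Ω) (δ : ℝ)
    (dS : Ω → Measure ℝ) : ℝ≥0∞ :=
  ∫⁻ ω, ∫⁻ t in Set.Ici 0, ENNReal.ofReal (Real.exp (-δ * t)) ∂(dS ω) ∂P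

/-- The value function `V_y(x)` of the strategy with threshold `y`. -/
noncomputable def thresholdValue [MeasurableSpace Ω] (P : Measure Ω) (r xs δ : ℝ)
    (τ Z : ℕ → Ω → ℝ) (y x : ℝ) : ℝ≥0∞ :=
  expectedCost P δ (thresholdTransfers r xs y x τ Z)

/-- The constant `a`. -/
noncomputable def paramA (r lam δ α : ℝ) : ℝ :=
  (-(δ + lam - α * r) - Real.sqrt ((δ + lam - α * r) ^ 2 + 4 * r * α * δ)) / (2 * r)

/-- The constant `b`. -/
noncomputable def paramB (r lam δ α : ℝ) : ℝ :=
  (-(δ + lam - α * r) + Real.sqrt ((δ + lam - α * r) ^ 2 + 4 * r * α * δ)) / (2 * r)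

/-- The constant `A(y)`, with `a`, `b` as above, `c = α` and `xs` the poverty line. For `y = xs` the
second summand of the denominator has the factor `y - xs = 0` and is absent. -/
noncomputable def coeffA (r xs lam δ α y : ℝ) : ℝ :=
  let a := paramA r lam δ α
  let b := paramB r lam δ α
  let c := α
  lam * y /
    (₂F₁ b (b - c + 1) (b - a + 1) (xs / y) * δ * (xs / y) ^ b * (α + 1) +
      ₂F₁ (b + 1) (b - c + 1) (b - a + 1) (xs / y) * r * (y - xs) * (b / y) * (xs / y) ^ b *
        (α + 1))

end SocialProtection

/-! The value satisfies a one-step renewal equation, and a bounded solution of that equation is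
forced to be the value. Let `h` have slope `-1` below `y` and equal `A` times `profile` above it. If
`h k = E[exp (-δ T) h (flow_T(k) Z)]` for `k ≥ y`, with `T` exponential and `Z` Beta, then the
`n`-th expected discounted transfer equals `m n - m (n + 1)`, where `m n` is the expected discounted
value of `h` just before the `n`-th transfer. The sum telescopes to `h x`, because `m n` is at most
a constant times `(lam / (lam + δ)) ^ n`. This is `tendsto_sum_discount_transfer`; it rests on the
independence of past and next step, `indepFun_state`.

The renewal equation holds once `lam * E[h (k Z)] = (lam + δ) h - r (k - xs) h'` for `k ≥ y`
(`mul_integral_candidate`): integrate along the flow. For the Beta law, `k ^ α * E[h (k Z)]` is a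
primitive of `α k ^ (α - 1) h`, so differentiating in `k` leaves a second-order equation, which in
`u = xs / k` is Gauss's equation for `u ^ (-b) h` (`hasDerivAt_rpow_mul_profile`). The constant of
integration, fixed at `k = y`, determines `A(y)`.

Two points need care. When `y = xs` the series is evaluated at `u = 1`. There `c - a - b = (δ + lam)
/ r > 0` gives absolute convergence, and `(1 - u) F'(u)` tends to `0` by Abel's theorem. Also, the
denominator of `A(y)` must not vanish: otherwise `profile`, with slope `0` below `y`, would be a
bounded solution of the equation without transfers, hence zero by the same telescoping, whereas it
is nonzero for large capital. The factor `κ` in `candidate` lets one argument serve both `κ = 1` and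
`κ = 0`. -/

namespace SocialProtection

open Filter Topology

/-! ### The Gauss hypergeometric series on `[0, 1]` -/

section Hypergeometric

lemma ordinaryHypergeometricCoefficient_succ {p q s : ℝ} (hs : 0 < s) (n : ℕ) :
    ordinaryHypergeometricCoefficient p q s (n + 1) * ((n + 1) * (s + n)) =
      ordinaryHypergeometricCoefficient p q s n * ((p + n) * (q + n)) := by
  have h1 : (n + 1 : ℝ) ≠ 0 := by positivity
  have h2 : (s + n : ℝ) ≠ 0 := by positivity
  have h3 : (ascPochhammer ℝ n).eval s ≠ 0 := (ascPochhammer_pos n s hs).ne'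
  have h4 : (n.factorial : ℝ) ≠ 0 := by positivity
  simp only [ordinaryHypergeometricCoefficient, ascPochhammer_succ_eval, Nat.factorial_succ]
  push_cast
  field_simp

/-- Coefficient form of `p F(p + 1) = (p + u d/du) F`, which makes the second hypergeometric
function in `A(y)` a derivative of the first. -/
lemma mul_ordinaryHypergeometricCoefficient_add_one (p q s : ℝ) (n : ℕ) :
    p * ordinaryHypergeometricCoefficient (p + 1) q s n =
      (p + n) * ordinaryHypergeometricCoefficient p q s n := by
  have h : p * (ascPochhammer ℝ n).eval (p + 1) = (ascPochhammer ℝ n).eval p * (p + n) := by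
    rw [← ascPochhammer_succ_eval, ascPochhammer_succ_left]
    simp
  simp only [ordinaryHypergeometricCoefficient]
  linear_combination ((n.factorial : ℝ)⁻¹ * (ascPochhammer ℝ n).eval q *
    ((ascPochhammer ℝ n).eval s)⁻¹) * h

lemma ordinaryHypergeometric_eq_tsum_coefficient (p q s u : ℝ) :
    ₂F₁ p q s u = ∑' n, ordinaryHypergeometricCoefficient p q s n * u ^ n := by
  rw [ordinaryHypergeometric_eq_tsum]
  simp [ordinaryHypergeometricCoefficient]

/-- Raabe's test in telescoping form. By the recurrence it reduces to `n (s + n) - (p + n) (q + n) =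
(s - p - q) n - p q`, which eventually exceeds half of `(s - p - q) (s + n)`. Both summability of
the coefficients and `n C n → 0` follow from it. -/
lemma eventually_mul_abs_coefficient_le {p q s : ℝ} (hs : 0 < s) (h : 0 < s - p - q) :
    ∃ N : ℕ, ∀ n ≥ N, (s - p - q) / 2 * |ordinaryHypergeometricCoefficient p q s n| ≤
      n * |ordinaryHypergeometricCoefficient p q s n| -
        (n + 1 : ℕ) * |ordinaryHypergeometricCoefficient p q s (n + 1)| := by
  have e1 : ∀ᶠ n : ℕ in atTop, -p ≤ n := tendsto_natCast_atTop_atTop.eventually_ge_atTop _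
  have e2 : ∀ᶠ n : ℕ in atTop, -q ≤ n := tendsto_natCast_atTop_atTop.eventually_ge_atTop _
  have e3 : ∀ᶠ n : ℕ in atTop, (p * q + (s - p - q) / 2 * s) / ((s - p - q) / 2) ≤ n :=
    tendsto_natCast_atTop_atTop.eventually_ge_atTop _
  obtain ⟨N, hN⟩ := eventually_atTop.1 (e1.and (e2.and e3))
  refine ⟨N, fun n hn => ?_⟩
  obtain ⟨h1, h2, h3⟩ := hN n hn
  rw [div_le_iff₀ (by positivity)] at h3
  have hrec := ordinaryHypergeometricCoefficient_succ (p := p) (q := q) hs n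
  have hsn : 0 < s + n := by positivity
  push_cast
  generalize ordinaryHypergeometricCoefficient p q s (n + 1) = B at hrec ⊢
  generalize ordinaryHypergeometricCoefficient p q s n = A at hrec ⊢
  replace hrec := congrArg abs hrec
  rw [abs_mul, abs_mul, abs_mul, abs_mul, abs_of_nonneg (by linarith : 0 ≤ p + n),
    abs_of_nonneg (by linarith : 0 ≤ q + n), abs_of_pos hsn,
    abs_of_pos (by positivity : (0 : ℝ) < n + 1)] at hrec
  refine le_of_mul_le_mul_right ?_ hsn
  have : |A| * ((s - p - q) / 2 * (s + n)) ≤ |A| * (n * (s + n) - (p + n) * (q + n)) :=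
    mul_le_mul_of_nonneg_left (by linarith) (abs_nonneg A)
  linarith

lemma summable_abs_ordinaryHypergeometricCoefficient {p q s : ℝ} (hs : 0 < s)
    (h : 0 < s - p - q) :
    Summable fun n => |ordinaryHypergeometricCoefficient p q s n| := by
  obtain ⟨N, hN⟩ := eventually_mul_abs_coefficient_le hs h
  rw [← summable_nat_add_iff N]
  set w : ℕ → ℝ := fun n => n * |ordinaryHypergeometricCoefficient p q s n| with hw
  refine summable_of_sum_range_le (c := w N / ((s - p - q) / 2)) (fun n => abs_nonneg _)
    fun m => ?_
  rw [le_div_iff₀ (by positivity), mul_comm, Finset.mul_sum]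
  calc _ ≤ ∑ i ∈ Finset.range m, (w (i + N) - w (i + 1 + N)) := by
        refine Finset.sum_le_sum fun i _ => ?_
        have := hN (i + N) (by omega)
        rw [show i + 1 + N = i + N + 1 by ring]
        exact this
    _ = w (0 + N) - w (m + N) := Finset.sum_range_sub' (fun i => w (i + N)) m
    _ ≤ w N := by
        have : 0 ≤ w (m + N) := by positivity
        simpa using this

lemma tendsto_mul_ordinaryHypergeometricCoefficient {p q s : ℝ} (hs : 0 < s)
    (h : 0 < s - p - q) :
    Tendsto (fun n : ℕ => n * ordinaryHypergeometricCoefficient p q s n) atTop (𝓝 0) := by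
  obtain ⟨N, hN⟩ := eventually_mul_abs_coefficient_le hs h
  set w : ℕ → ℝ := fun n => n * |ordinaryHypergeometricCoefficient p q s n| with hw
  have hw0 : ∀ n, 0 ≤ w n := fun n => by positivity
  have hanti : Antitone fun n => w (n + N) := antitone_nat_of_succ_le fun n => by
    have := hN (n + N) (by omega)
    have h2 : 0 ≤ (s - p - q) / 2 * |ordinaryHypergeometricCoefficient p q s (n + N)| := by
      positivity
    rw [show n + 1 + N = n + N + 1 by ring]
    simp only [hw]
    linarith
  have hlim := tendsto_atTop_ciInf hanti ⟨0, by rintro _ ⟨n, rfl⟩; exact hw0 _⟩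
  set L := ⨅ n, w (n + N)
  have hLle : ∀ n, L ≤ w (n + N) := fun n => hanti.le_of_tendsto hlim n
  have hL0 : 0 ≤ L := le_ciInf fun n => hw0 _
  -- A positive limit would give `|C n| ≥ L / n` for large `n`, so the harmonic series would
  -- converge.
  have hL : L = 0 := by
    by_contra hne
    have hLpos : 0 < L := lt_of_le_of_ne hL0 (Ne.symm hne)
    refine Real.not_summable_natCast_inv ?_
    rw [← summable_nat_add_iff (N + 1)]
    have hsum := (summable_nat_add_iff (N + 1)).2
      (summable_abs_ordinaryHypergeometricCoefficient (p := p) (q := q) hs h)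
    refine Summable.of_nonneg_of_le (fun n => by positivity) (fun n => ?_) (hsum.mul_left L⁻¹)
    have hn : (0 : ℝ) < (n + (N + 1) : ℕ) := by positivity
    rw [inv_eq_one_div, div_le_iff₀ hn, mul_assoc, inv_mul_eq_div, le_div_iff₀ hLpos, one_mul,
      mul_comm]
    have := hLle (n + 1)
    rw [show n + 1 + N = n + (N + 1) by ring] at this
    exact this
  rw [hL] at hlim
  have := (tendsto_add_atTop_iff_nat N).1 hlim
  rw [tendsto_zero_iff_abs_tendsto_zero]
  refine this.congr fun n => ?_
  simp [hw, abs_mul]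

/-- The Euler operator `u d/du`, applied `j` times to a power series with coefficients `C`. -/
noncomputable def eulerSeries (C : ℕ → ℝ) (j : ℕ) (u : ℝ) : ℝ :=
  ∑' n : ℕ, (n : ℝ) ^ j * C n * u ^ n

lemma summable_eulerSeries {C : ℕ → ℝ} (hC : Summable fun n => |C n|) (j : ℕ) {u : ℝ}
    (hu : |u| < 1) : Summable fun n : ℕ => (n : ℝ) ^ j * C n * u ^ n := by
  obtain ⟨K, hK⟩ := hC.tendsto_atTop_zero.bddAbove_range
  have h := (summable_pow_mul_geometric_of_norm_lt_one j
    (r := |u|) (by simpa using hu)).mul_left K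
  refine Summable.of_norm_bounded h fun n => ?_
  have h1 : |C n| ≤ K := hK ⟨n, rfl⟩
  rw [Real.norm_eq_abs, abs_mul, abs_mul, abs_pow, abs_pow, Nat.abs_cast]
  calc (n : ℝ) ^ j * |C n| * |u| ^ n ≤ (n : ℝ) ^ j * K * |u| ^ n := by gcongr
    _ = _ := by ring

lemma hasDerivAt_eulerSeries {C : ℕ → ℝ} (hC : Summable fun n => |C n|) (j : ℕ) {u : ℝ}
    (h0 : 0 < u) (h1 : u < 1) :
    HasDerivAt (eulerSeries C j) (eulerSeries C (j + 1) u / u) u := by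
  obtain ⟨ρ, hρ, hρ1⟩ := exists_between h1
  have hρ0 : 0 < ρ := h0.trans hρ
  have hs : Summable fun n : ℕ => ρ⁻¹ * ‖(n : ℝ) ^ (j + 1) * C n * ρ ^ n‖ :=
    ((summable_eulerSeries hC (j + 1) (abs_lt.2 ⟨by linarith, hρ1⟩)).norm).mul_left _
  have key := hasDerivAt_tsum_of_isPreconnected (y₀ := u) (y := u) hs (isOpen_Ioo (a := -ρ) (b := ρ))
    isPreconnected_Ioo
    (g := fun (n : ℕ) v => (n : ℝ) ^ j * C n * v ^ n)
    (g' := fun (n : ℕ) v => (n : ℝ) ^ j * C n * (n * v ^ (n - 1)))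
    (fun n v _ => (hasDerivAt_pow n v).const_mul _) ?_ ⟨by linarith, hρ⟩
    (summable_eulerSeries hC j (abs_lt.2 ⟨by linarith, h1⟩)) ⟨by linarith, hρ⟩
  · convert! key using 1
    rw [eulerSeries, ← tsum_div_const]
    refine tsum_congr fun n => ?_
    rcases n with _ | n
    · simp
    · field_simp
      simp
      ring
  · rintro n v ⟨hv1, hv2⟩
    have hv : |v| ≤ ρ := abs_le.2 ⟨hv1.le, hv2.le⟩
    rcases n with _ | n
    · simp
    · simp only [norm_mul, norm_pow, Real.norm_eq_abs, Nat.abs_cast, abs_of_pos hρ0,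
        Nat.add_sub_cancel]
      calc _ ≤ ((n + 1 : ℕ) : ℝ) ^ j * |C (n + 1)| * (((n + 1 : ℕ) : ℝ) * ρ ^ n) := by gcongr
        _ = _ := by field_simp; ring

variable {p q s : ℝ}

lemma ordinaryHypergeometric_eq_eulerSeries (p q s u : ℝ) :
    ₂F₁ p q s u = eulerSeries (ordinaryHypergeometricCoefficient p q s) 0 u := by
  simp [ordinaryHypergeometric_eq_tsum_coefficient, eulerSeries]

lemma continuousOn_ordinaryHypergeometric (hs : 0 < s) (h : 0 < s - p - q) :
    ContinuousOn (fun u : ℝ => ₂F₁ p q s u) (Set.Icc 0 1) := by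
  simp_rw [ordinaryHypergeometric_eq_tsum_coefficient]
  refine continuousOn_tsum (fun n => by fun_prop)
    (summable_abs_ordinaryHypergeometricCoefficient hs h) fun n u hu => ?_
  rw [norm_mul, norm_pow, Real.norm_eq_abs, Real.norm_eq_abs, abs_of_nonneg hu.1]
  exact mul_le_of_le_one_right (abs_nonneg _) (pow_le_one₀ hu.1 hu.2)

lemma mul_ordinaryHypergeometric_add_one (hs : 0 < s) (h : 0 < s - p - q) {u : ℝ}
    (hu : |u| < 1) :
    p * ₂F₁ (p + 1) q s u =
      p * eulerSeries (ordinaryHypergeometricCoefficient p q s) 0 u +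
        eulerSeries (ordinaryHypergeometricCoefficient p q s) 1 u := by
  have hC := summable_abs_ordinaryHypergeometricCoefficient hs h
  rw [ordinaryHypergeometric_eq_tsum_coefficient, eulerSeries, eulerSeries, ← tsum_mul_left,
    ← tsum_mul_left, ← Summable.tsum_add ((summable_eulerSeries hC 0 hu).mul_left p)
      (summable_eulerSeries hC 1 hu)]
  refine tsum_congr fun n => ?_
  rw [← mul_assoc, mul_ordinaryHypergeometricCoefficient_add_one]
  ring

/-- Gauss's differential equation, written with the Euler operator. -/
lemma eulerSeries_gauss (hs : 0 < s) (h : 0 < s - p - q) {u : ℝ} (hu : |u| < 1) :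
    eulerSeries (ordinaryHypergeometricCoefficient p q s) 2 u +
        (s - 1) * eulerSeries (ordinaryHypergeometricCoefficient p q s) 1 u =
      u * (eulerSeries (ordinaryHypergeometricCoefficient p q s) 2 u +
        (p + q) * eulerSeries (ordinaryHypergeometricCoefficient p q s) 1 u +
        p * q * eulerSeries (ordinaryHypergeometricCoefficient p q s) 0 u) := by
  have hC := summable_abs_ordinaryHypergeometricCoefficient hs h
  have S := fun j => (summable_eulerSeries hC j hu).hasSum
  have hl := (S 2).add ((S 1).mul_left (s - 1))
  have hr := (((S 2).add ((S 1).mul_left (p + q))).add ((S 0).mul_left (p * q))).mul_left u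
  -- The constant term on the left is zero; dropping it absorbs the factor `u` on the right and
  -- reduces the claim to the coefficient recurrence.
  rw [← hasSum_nat_add_iff' 1] at hl
  have heq := hl.unique (hr.congr_fun fun n => ?_)
  · simpa [eulerSeries] using heq
  · have := ordinaryHypergeometricCoefficient_succ (p := p) (q := q) hs n
    push_cast
    linear_combination (u ^ (n + 1)) * this

/-- Multiplying by `1 - u` differences the coefficients `f n = n C n`; the partial sums of the
differences are again `f N`, which tend to `0`, and Abel's limit theorem applies. The derivative
itself may blow up at `1`. -/
lemma tendsto_one_sub_mul_eulerSeries_one (hs : 0 < s) (h : 0 < s - p - q) :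
    Tendsto (fun u => (1 - u) * eulerSeries (ordinaryHypergeometricCoefficient p q s) 1 u)
      (𝓝[<] 1) (𝓝 0) := by
  have hC := summable_abs_ordinaryHypergeometricCoefficient hs h
  set f : ℕ → ℝ := fun n => n * ordinaryHypergeometricCoefficient p q s n with hf
  set g : ℕ → ℝ := fun n => Nat.casesOn n 0 f with hg
  have hpart : Tendsto (fun N => ∑ i ∈ Finset.range N, (f i - g i)) atTop (𝓝 0) := by
    rw [← tendsto_add_atTop_iff_nat 1]
    refine (tendsto_mul_ordinaryHypergeometricCoefficient hs h).congr fun N => ?_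
    rw [Finset.sum_range_succ', Finset.sum_range_sub]
    simp [hf, hg]
  refine (Real.tendsto_tsum_powerSeries_nhdsWithin_lt hpart).congr' ?_
  filter_upwards [Ioo_mem_nhdsLT (zero_lt_one' ℝ)] with u hu
  have hu' : |u| < 1 := abs_lt.2 ⟨by linarith [hu.1], hu.2⟩
  have h1 : HasSum (fun n => f n * u ^ n)
      (eulerSeries (ordinaryHypergeometricCoefficient p q s) 1 u) := by
    simpa [hf, eulerSeries] using (summable_eulerSeries hC 1 hu').hasSum
  have h2 : HasSum (fun n => g n * u ^ n)
      (u * eulerSeries (ordinaryHypergeometricCoefficient p q s) 1 u) := by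
    rw [← hasSum_nat_add_iff' 1]
    convert! h1.mul_left u using 1
    · ext n
      simp only [hg]
      ring
    · simp [hg]
  rw [((h1.sub h2).congr_fun fun n => by ring : HasSum (fun n => (f n - g n) * u ^ n) _).tsum_eq]
  ring

lemma continuousOn_one_sub_mul_ordinaryHypergeometric (hs : 0 < s) (h : 0 < s - p - q) :
    ContinuousOn (fun u : ℝ => (1 - u) * (p * ₂F₁ (p + 1) q s u)) (Set.Ioc 0 1) := by
  have hC := summable_abs_ordinaryHypergeometricCoefficient hs h
  set C := ordinaryHypergeometricCoefficient p q s with hCdef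
  intro u hu
  rcases hu.2.lt_or_eq with h1 | rfl
  · have hd := fun j => (hasDerivAt_eulerSeries hC j hu.1 h1).continuousAt
    have hc : ContinuousAt (fun u => (1 - u) * (p * eulerSeries C 0 u + eulerSeries C 1 u)) u :=
      (continuousAt_const.sub continuousAt_id).mul ((continuousAt_const.mul (hd 0)).add (hd 1))
    refine (hc.congr ?_).continuousWithinAt
    filter_upwards [Ioo_mem_nhds hu.1 h1] with v hv
    rw [mul_ordinaryHypergeometric_add_one hs h (abs_lt.2 ⟨by linarith [hv.1], hv.2⟩)]
  · rw [← Set.Ioo_insert_right zero_lt_one, continuousWithinAt_insert_self]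
    have hF : Tendsto (fun u : ℝ => ₂F₁ p q s u) (𝓝[Set.Ioo 0 1] 1) (𝓝 (₂F₁ p q s 1)) :=
      ((continuousOn_ordinaryHypergeometric hs h) 1 (by simp)).mono Set.Ioo_subset_Icc_self
    have hT := (tendsto_one_sub_mul_eulerSeries_one hs h).mono_left
      (nhdsWithin_mono 1 (Set.Ioo_subset_Iio_self (a := (0 : ℝ))))
    have h0 : Tendsto (fun u : ℝ => 1 - u) (𝓝[Set.Ioo 0 1] 1) (𝓝 (1 - 1)) :=
      ((continuous_const.sub continuous_id).tendsto 1).mono_left nhdsWithin_le_nhds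
    have := ((h0.mul (hF.const_mul p)).add hT)
    simp only [sub_self, zero_mul, add_zero] at this
    rw [ContinuousWithinAt, sub_self, zero_mul]
    refine this.congr' ?_
    filter_upwards [self_mem_nhdsWithin] with v hv
    rw [mul_ordinaryHypergeometric_add_one hs h (abs_lt.2 ⟨by linarith [hv.1], hv.2⟩),
      ordinaryHypergeometric_eq_eulerSeries]
    ring

end Hypergeometric

/-! ### The hypergeometric solution as a function of capital, and its differential equation. -/

section Profile

/-- The decreasing solution `u ^ p * ₂F₁ p q s u`, `u = xs / k`, of the equation of the model. -/
noncomputable def profile (p q s xs k : ℝ) : ℝ := ₂F₁ p q s (xs / k) * (xs / k) ^ p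

/-- The function `-(k - xs) * (profile p q s xs)' k`, extended by `0` to `k = xs`. -/
noncomputable def profileDrift (p q s xs k : ℝ) : ℝ :=
  (1 - xs / k) * (p * ₂F₁ (p + 1) q s (xs / k)) * (xs / k) ^ p

variable {p q s xs : ℝ}

lemma mapsTo_div_Ici (hxs : 0 < xs) : Set.MapsTo (fun k => xs / k) (Set.Ici xs) (Set.Ioc 0 1) :=
  fun _ hk => ⟨div_pos hxs (hxs.trans_le hk), div_le_one_of_le₀ hk (hxs.le.trans hk)⟩

lemma continuousOn_div_Ici (hxs : 0 < xs) : ContinuousOn (fun k => xs / k) (Set.Ici xs) :=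
  continuousOn_const.div continuousOn_id fun _ hk => (hxs.trans_le hk).ne'

lemma continuousOn_rpow_div_Ici (hxs : 0 < xs) :
    ContinuousOn (fun k => (xs / k) ^ p) (Set.Ici xs) :=
  (continuousOn_div_Ici hxs).rpow_const fun _ hk => Or.inl (mapsTo_div_Ici hxs hk).1.ne'

lemma continuousOn_profile (hxs : 0 < xs) (hs : 0 < s) (h : 0 < s - p - q) :
    ContinuousOn (profile p q s xs) (Set.Ici xs) :=
  ((continuousOn_ordinaryHypergeometric hs h).comp (continuousOn_div_Ici hxs)
    fun _ hk => Set.Ioc_subset_Icc_self (mapsTo_div_Ici hxs hk)).mul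
    (continuousOn_rpow_div_Ici hxs)

lemma continuousOn_profileDrift (hxs : 0 < xs) (hs : 0 < s) (h : 0 < s - p - q) :
    ContinuousOn (profileDrift p q s xs) (Set.Ici xs) :=
  ((continuousOn_one_sub_mul_ordinaryHypergeometric hs h).comp (continuousOn_div_Ici hxs)
    (mapsTo_div_Ici hxs)).mul (continuousOn_rpow_div_Ici hxs)

lemma exists_abs_profile_le (hxs : 0 < xs) (hp : 0 < p) (hs : 0 < s) (h : 0 < s - p - q) :
    ∃ M, ∀ k, xs ≤ k → |profile p q s xs k| ≤ M := by
  obtain ⟨M, hM⟩ := isCompact_Icc.exists_bound_of_continuousOn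
    (continuousOn_ordinaryHypergeometric (p := p) (q := q) hs h)
  refine ⟨M, fun k hk => ?_⟩
  have hu := mapsTo_div_Ici hxs hk
  have h1 := hM _ (Set.Ioc_subset_Icc_self hu)
  have h2 : (xs / k) ^ p ≤ 1 := Real.rpow_le_one hu.1.le hu.2 hp.le
  have h3 : 0 ≤ (xs / k) ^ p := Real.rpow_nonneg hu.1.le p
  rw [profile, abs_mul, abs_of_nonneg h3]
  exact (mul_le_of_le_one_right (abs_nonneg _) h2).trans h1

/-- As `k → ∞`, `xs / k → 0` and the hypergeometric factor tends to `1`. This rules out a vanishing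
denominator in `A(y)`. -/
lemma exists_profile_ne_zero (hxs : 0 < xs) (hs : 0 < s) (h : 0 < s - p - q) (y : ℝ) :
    ∃ k, y ≤ k ∧ profile p q s xs k ≠ 0 := by
  have hc := (continuousOn_ordinaryHypergeometric (p := p) (q := q) hs h) 0 (by simp)
  have hu : Tendsto (fun k => xs / k) atTop (𝓝[Set.Icc 0 1] 0) := by
    refine tendsto_nhdsWithin_iff.2 ⟨tendsto_const_nhds.div_atTop tendsto_id, ?_⟩
    filter_upwards [eventually_ge_atTop xs] with k hk
    exact Set.Ioc_subset_Icc_self (mapsTo_div_Ici hxs hk)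
  have hlim := hc.tendsto.comp hu
  rw [ordinaryHypergeometric_zero] at hlim
  obtain ⟨k, hk, hk1, hk2⟩ := ((hlim.eventually_ne one_ne_zero).and
    ((eventually_ge_atTop y).and (eventually_ge_atTop xs))).exists
  exact ⟨k, hk1, mul_ne_zero hk (Real.rpow_pos_of_pos (mapsTo_div_Ici hxs hk2).1 p).ne'⟩

variable {k : ℝ}

lemma hasDerivAt_const_div_self (hk : 0 < k) : HasDerivAt (fun k => xs / k) (-(xs / k) / k) k := by
  convert! (hasDerivAt_inv hk.ne').const_mul xs using 1
  field_simp

lemma hasDerivAt_rpow_const_div_self (hxs : 0 < xs) (hk : xs < k) :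
    HasDerivAt (fun k => (xs / k) ^ p) (-(p * (xs / k) ^ p) / k) k := by
  have hk0 := hxs.trans hk
  have hu : 0 < xs / k := div_pos hxs hk0
  convert! (hasDerivAt_const_div_self hk0).rpow_const (p := p) (Or.inl hu.ne') using 1
  rw [Real.rpow_sub_one hu.ne']
  field_simp

lemma hasDerivAt_eulerSeries_const_div_self (hxs : 0 < xs) (hs : 0 < s) (h : 0 < s - p - q)
    (hk : xs < k) (j : ℕ) :
    HasDerivAt (fun k => eulerSeries (ordinaryHypergeometricCoefficient p q s) j (xs / k))
      (-eulerSeries (ordinaryHypergeometricCoefficient p q s) (j + 1) (xs / k) / k) k := by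
  have hk0 := hxs.trans hk
  have hu : 0 < xs / k := div_pos hxs hk0
  have hC := summable_abs_ordinaryHypergeometricCoefficient hs h
  have := (hasDerivAt_eulerSeries hC j hu ((div_lt_one hk0).2 hk)).comp k
    (hasDerivAt_const_div_self hk0)
  convert! this using 1
  generalize eulerSeries (ordinaryHypergeometricCoefficient p q s) (j + 1) (xs / k) = e
  field_simp

lemma profile_eq_eulerSeries (k : ℝ) : profile p q s xs k =
    eulerSeries (ordinaryHypergeometricCoefficient p q s) 0 (xs / k) * (xs / k) ^ p := by
  rw [profile, ordinaryHypergeometric_eq_eulerSeries]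

lemma profileDrift_eq_eulerSeries (hxs : 0 < xs) (hs : 0 < s) (h : 0 < s - p - q)
    (hk : xs < k) : profileDrift p q s xs k =
    (1 - xs / k) * (p * eulerSeries (ordinaryHypergeometricCoefficient p q s) 0 (xs / k) +
      eulerSeries (ordinaryHypergeometricCoefficient p q s) 1 (xs / k)) * (xs / k) ^ p := by
  have hk0 := hxs.trans hk
  have hu : 0 < xs / k := div_pos hxs hk0
  rw [profileDrift, mul_ordinaryHypergeometric_add_one hs h
    (abs_lt.2 ⟨by linarith, (div_lt_one hk0).2 hk⟩)]

lemma hasDerivAt_profile (hxs : 0 < xs) (hs : 0 < s) (h : 0 < s - p - q) (hk : xs < k) :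
    HasDerivAt (profile p q s xs) (-profileDrift p q s xs k / (k - xs)) k := by
  have hk0 := hxs.trans hk
  have hd := (hasDerivAt_eulerSeries_const_div_self hxs hs h hk 0).mul
    (hasDerivAt_rpow_const_div_self (p := p) hxs hk)
  rw [funext (profile_eq_eulerSeries (p := p) (q := q) (s := s) (xs := xs))]
  convert! hd using 1
  rw [profileDrift_eq_eulerSeries hxs hs h hk]
  generalize eulerSeries (ordinaryHypergeometricCoefficient p q s) 0 (xs / k) = e0
  generalize eulerSeries (ordinaryHypergeometricCoefficient p q s) (0 + 1) (xs / k) = e1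
  generalize (xs / k) ^ p = v
  have : k - xs ≠ 0 := by linarith
  field_simp
  ring

/-- Write `θ = u d/du`; on `u ^ p F` the operator `-k d/dk` acts as `θ + p` on `F`. Sorting by
powers of `u`, the terms without `u` give the indicial polynomial at `p` (zero by `hp`) and `-r θ (θ
+ s - 1) F` (by `hsp`); those with `u` give `r u (θ + p) (θ + q) F` (by `hq`). Their sum vanishes by
Gauss's equation. -/
lemma hasDerivAt_rpow_mul_profile {r α lam δ : ℝ} (hxs : 0 < xs) (hs : 0 < s)
    (h : 0 < s - p - q) (hp : r * p ^ 2 + (δ + lam - α * r) * p - α * δ = 0)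
    (hq : q = p - α + 1) (hsp : r * (s - 1) = 2 * r * p + (δ + lam - α * r)) (hk : xs < k) :
    HasDerivAt (fun k => k ^ α * ((lam + δ) * profile p q s xs k + r * profileDrift p q s xs k))
      (lam * α * (k ^ (α - 1) * profile p q s xs k)) k := by
  have hk0 := hxs.trans hk
  have hu : 0 < xs / k := div_pos hxs hk0
  have h0 := hasDerivAt_eulerSeries_const_div_self hxs hs h hk 0
  have h1 := hasDerivAt_eulerSeries_const_div_self hxs hs h hk 1
  have hv := hasDerivAt_rpow_const_div_self (p := p) hxs hk
  have hd := (Real.hasDerivAt_rpow_const (p := α) (Or.inl hk0.ne')).mul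
    (((h0.mul hv).const_mul (lam + δ)).add
    (((((hasDerivAt_const_div_self (xs := xs) hk0).const_sub 1).mul ((h0.const_mul p).add h1)).mul
      hv).const_mul r))
  have hode := eulerSeries_gauss hs h (abs_lt.2 ⟨by linarith, (div_lt_one hk0).2 hk⟩)
  refine HasDerivAt.congr_of_eventuallyEq (HasDerivAt.congr_deriv hd ?_) ?_
  · simp only [Nat.reduceAdd, profile_eq_eulerSeries, Pi.add_apply, Pi.mul_apply]
    generalize eulerSeries (ordinaryHypergeometricCoefficient p q s) 0 (xs / k) = e0 at hode ⊢
    generalize eulerSeries (ordinaryHypergeometricCoefficient p q s) 1 (xs / k) = e1 at hode ⊢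
    generalize eulerSeries (ordinaryHypergeometricCoefficient p q s) 2 (xs / k) = e2 at hode ⊢
    generalize (xs / k) ^ p = v
    have hpow : k ^ α = k ^ (α - 1) * k := by
      rw [← Real.rpow_add_one hk0.ne', sub_add_cancel]
    rw [hpow]
    generalize k ^ (α - 1) = w
    generalize xs / k = u at hode ⊢
    field_simp
    subst hq
    linear_combination (-w * v * r) * hode + (w * v * e1) * hsp - (w * v * e0) * hp
  · filter_upwards [Ioi_mem_nhds hk] with x hx
    simp only [Pi.mul_apply, Pi.add_apply]
    rw [profile_eq_eulerSeries, profileDrift_eq_eulerSeries hxs hs h hx]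

end Profile

/-! ### Integration against the Beta and exponential laws. -/

section Laws

lemma measurable_betaPDF (α β : ℝ) : Measurable (betaPDF α β) :=
  (measurable_betaPDFReal α β).ennreal_ofReal

lemma measurable_exponentialPDF (lam : ℝ) : Measurable (exponentialPDF lam) :=
  (measurable_exponentialPDFReal lam).ennreal_ofReal

lemma integral_betaMeasure_one {α : ℝ} (hα : 0 < α) (f : ℝ → ℝ) :
    ∫ z, f z ∂betaMeasure α 1 = ∫ z in (0 : ℝ)..1, α * z ^ (α - 1) * f z := by
  have hb : 1 / beta α 1 = α := by
    rw [beta, Real.Gamma_one, Real.Gamma_add_one hα.ne']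
    have := (Real.Gamma_pos_of_pos hα).ne'
    field_simp
  rw [betaMeasure, integral_withDensity_eq_integral_toReal_smul
    (measurable_betaPDF α 1) (by simp [betaPDF]),
    intervalIntegral.integral_of_le zero_le_one, integral_Ioc_eq_integral_Ioo,
    ← integral_indicator measurableSet_Ioo]
  refine integral_congr_ae (Eventually.of_forall fun z => ?_)
  by_cases hz : z ∈ Set.Ioo (0 : ℝ) 1
  · simp only [betaPDF, Set.indicator_of_mem hz]
    rw [ENNReal.toReal_ofReal (betaPDFReal_pos hz.1 hz.2 hα one_pos).le, betaPDFReal,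
      if_pos ⟨hz.1, hz.2⟩, hb]
    simp
  · simp only [Set.indicator_of_notMem hz, betaPDF, betaPDFReal]
    rw [if_neg (by simpa using hz)]
    simp

/-- The substitution `u = k z` moves the dependence on `k` into the endpoint, so the average over a
loss can be differentiated in `k` without differentiating `f`. -/
lemma rpow_mul_integral_betaMeasure_one {α k : ℝ} (hα : 0 < α) (hk : 0 < k) (f : ℝ → ℝ) :
    k ^ α * ∫ z, f (k * z) ∂betaMeasure α 1 = α * ∫ u in (0 : ℝ)..k, u ^ (α - 1) * f u := by
  have h := intervalIntegral.integral_comp_mul_left (a := 0) (b := 1)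
    (fun u => u ^ (α - 1) * f u) hk.ne'
  rw [mul_zero, mul_one, smul_eq_mul, eq_inv_mul_iff_mul_eq₀ hk.ne'] at h
  rw [integral_betaMeasure_one hα, ← h, ← intervalIntegral.integral_const_mul,
    ← intervalIntegral.integral_const_mul, ← intervalIntegral.integral_const_mul]
  refine intervalIntegral.integral_congr fun z hz => ?_
  rw [Set.uIcc_of_le zero_le_one] at hz
  rw [Real.mul_rpow hk.le hz.1, Real.rpow_sub_one hk.ne']
  field_simp

lemma ae_mem_Ioo_betaMeasure (α β : ℝ) : ∀ᵐ z ∂betaMeasure α β, z ∈ Set.Ioo (0 : ℝ) 1 := by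
  rw [betaMeasure, ae_withDensity_iff (measurable_betaPDF α β)]
  refine Eventually.of_forall fun z hz => ?_
  by_contra h
  exact hz (by rw [betaPDF, betaPDFReal, if_neg (by simpa using h), ENNReal.ofReal_zero])

lemma integral_expMeasure {lam : ℝ} (hlam : 0 < lam) (f : ℝ → ℝ) :
    ∫ t, f t ∂expMeasure lam = ∫ t in Set.Ioi 0, lam * Real.exp (-(lam * t)) * f t := by
  change ∫ t, f t ∂volume.withDensity (exponentialPDF lam) = _
  rw [integral_withDensity_eq_integral_toReal_smul
    (measurable_exponentialPDF lam) (by simp [exponentialPDF]),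
    ← integral_Ici_eq_integral_Ioi, ← integral_indicator measurableSet_Ici]
  refine integral_congr_ae (Eventually.of_forall fun t => ?_)
  by_cases ht : t ∈ Set.Ici (0 : ℝ)
  · simp only [Set.indicator_of_mem ht]
    rw [exponentialPDF_of_nonneg ht, ENNReal.toReal_ofReal (by positivity), smul_eq_mul]
  · simp only [Set.indicator_of_notMem ht]
    rw [exponentialPDF_of_neg (by simpa using ht)]
    simp

lemma ae_nonneg_expMeasure (lam : ℝ) : ∀ᵐ t ∂expMeasure lam, 0 ≤ t := by
  change ∀ᵐ t ∂volume.withDensity (exponentialPDF lam), 0 ≤ t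
  rw [ae_withDensity_iff (measurable_exponentialPDF lam)]
  refine Eventually.of_forall fun t ht => ?_
  by_contra h
  exact ht (exponentialPDF_of_neg (not_le.1 h))

end Laws

/-! ### Growth of capital between losses. -/

section Flow

variable {r xs k : ℝ}

lemma flow_zero (r xs k : ℝ) : flow r xs 0 k = k := by simp [flow]

lemma lt_flow (hk : xs < k) (t : ℝ) : xs < flow r xs t k := by
  rw [flow, if_pos hk]
  have := mul_pos (sub_pos.2 hk) (Real.exp_pos (r * t))
  linarith

lemma le_flow (hr : 0 < r) {t : ℝ} (ht : 0 ≤ t) : k ≤ flow r xs t k := by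
  rw [flow]
  split_ifs with hk
  · have h1 : 1 ≤ Real.exp (r * t) := Real.one_le_exp (by positivity)
    nlinarith [sub_pos.2 hk]
  · exact le_rfl

lemma le_flow_of_le (hk : xs ≤ k) (t : ℝ) : xs ≤ flow r xs t k := by
  rcases hk.lt_or_eq with hk | rfl
  · exact (lt_flow hk t).le
  · simp [flow]

lemma hasDerivAt_flow (hk : xs < k) (t : ℝ) :
    HasDerivAt (fun t => flow r xs t k) (r * (flow r xs t k - xs)) t := by
  simp only [flow, if_pos hk]
  convert! (((hasDerivAt_id t).const_mul r).exp.const_mul (k - xs)).add_const xs using 1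
  simp only [id]
  ring

lemma continuous_flow (k : ℝ) : Continuous fun t => flow r xs t k := by
  by_cases hk : xs < k
  · simp only [flow, if_pos hk]; fun_prop
  · simp only [flow, if_neg hk]; fun_prop

lemma measurable_flow : Measurable fun x : ℝ × ℝ => flow r xs x.1 x.2 := by
  unfold flow
  exact Measurable.ite (measurableSet_lt measurable_const measurable_snd) (by fun_prop)
    (by fun_prop)

lemma hasDerivAt_profile_flow {p q s : ℝ} (hxs : 0 < xs) (hs : 0 < s) (h : 0 < s - p - q)
    (hk : xs ≤ k) (t : ℝ) :
    HasDerivAt (fun t => profile p q s xs (flow r xs t k))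
      (-(r * profileDrift p q s xs (flow r xs t k))) t := by
  rcases hk.lt_or_eq with hk | rfl
  · have hf := lt_flow (r := r) hk t
    convert! (hasDerivAt_profile hxs hs h hf).comp t (hasDerivAt_flow hk t) using 1
    have : flow r xs t k - xs ≠ 0 := by linarith
    field_simp
  -- At the poverty line the flow is stationary and `profileDrift` is `0`, so no derivative of
  -- `profile` at `xs` is needed.
  · have hf : ∀ t, flow r xs t xs = xs := fun t => by simp [flow]
    simp only [hf]
    convert! hasDerivAt_const t (profile p q s xs xs) using 1
    simp [profileDrift, div_self hxs.ne']

end Flow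

/-! ### The candidate value function and its renewal equation. -/

section Candidate

/-- A function which is affine of slope `-κ` below `y` and a multiple of `profile` above. -/
noncomputable def candidate (p q s xs κ A y k : ℝ) : ℝ :=
  κ * max (y - k) 0 + A * profile p q s xs (max k y)

variable {p q s xs κ A y : ℝ}

lemma candidate_of_le {k : ℝ} (hk : k ≤ y) :
    candidate p q s xs κ A y k = κ * (y - k) + A * profile p q s xs y := by
  rw [candidate, max_eq_left (sub_nonneg.2 hk), max_eq_right hk]

lemma candidate_of_ge {k : ℝ} (hk : y ≤ k) :
    candidate p q s xs κ A y k = A * profile p q s xs k := by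
  rw [candidate, max_eq_right (sub_nonpos.2 hk), max_eq_left hk, mul_zero, zero_add]

lemma candidate_eq_add (k : ℝ) : candidate p q s xs κ A y k =
    κ * max (y - k) 0 + candidate p q s xs κ A y (max k y) := by
  rw [candidate_of_ge (le_max_right _ _), candidate]

lemma continuous_candidate (hxs : 0 < xs) (hs : 0 < s) (h : 0 < s - p - q) (hy : xs ≤ y) :
    Continuous (candidate p q s xs κ A y) := by
  have : Continuous fun k => profile p q s xs (max k y) :=
    (continuousOn_profile hxs hs h).comp_continuous (by fun_prop)
      fun k => hy.trans (le_max_right _ _)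
  unfold candidate
  fun_prop

lemma exists_abs_candidate_le (hxs : 0 < xs) (hp : 0 < p) (hs : 0 < s) (h : 0 < s - p - q)
    (hy : xs ≤ y) : ∃ M, ∀ k, 0 ≤ k → |candidate p q s xs κ A y k| ≤ M := by
  obtain ⟨M, hM⟩ := exists_abs_profile_le (q := q) hxs hp hs h
  have hy0 := hxs.trans_le hy
  refine ⟨|κ| * y + |A| * M, fun k hk => (abs_add_le _ _).trans ?_⟩
  rw [abs_mul, abs_mul, abs_of_nonneg (le_max_right (y - k) 0)]
  gcongr
  · exact max_le (by linarith) hy0.le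
  · exact hM _ (hy.trans (le_max_right _ _))

variable {r α lam δ : ℝ}

/-- After multiplication by `k ^ α` the integral splits at `y`: above, the differential equation
supplies a primitive; below, the integrand is explicit. The boundary terms at `y` cancel exactly
under `hA`, the equation that defines `A(y)` when `κ = 1`. -/
lemma mul_integral_candidate (hxs : 0 < xs) (hs : 0 < s) (h : 0 < s - p - q)
    (hp : r * p ^ 2 + (δ + lam - α * r) * p - α * δ = 0) (hq : q = p - α + 1)
    (hsp : r * (s - 1) = 2 * r * p + (δ + lam - α * r)) (hα : 0 < α) (hy : xs ≤ y)
    (hA : A * (δ * profile p q s xs y + r * profileDrift p q s xs y) =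
      κ * (lam * y / (α + 1))) {k : ℝ} (hk : y ≤ k) :
    lam * ∫ z, candidate p q s xs κ A y (k * z) ∂betaMeasure α 1 =
      A * ((lam + δ) * profile p q s xs k + r * profileDrift p q s xs k) := by
  have hy0 := hxs.trans_le hy
  have hk0 := hy0.trans_le hk
  have hkα := Real.rpow_pos_of_pos hk0 α
  refine mul_left_cancel₀ hkα.ne' ?_
  rw [mul_left_comm, rpow_mul_integral_betaMeasure_one hα hk0]
  have hint : ∀ a b, IntervalIntegrable
      (fun u => u ^ (α - 1) * candidate p q s xs κ A y u) volume a b := fun a b =>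
    (intervalIntegral.intervalIntegrable_rpow' (by linarith)).mul_continuousOn
      (continuous_candidate hxs hs h hy).continuousOn
  rw [← intervalIntegral.integral_add_adjacent_intervals (hint 0 y) (hint y k)]
  have hfar : lam * α * ∫ u in y..k, u ^ (α - 1) * candidate p q s xs κ A y u =
      A * (k ^ α * ((lam + δ) * profile p q s xs k + r * profileDrift p q s xs k)) -
      A * (y ^ α * ((lam + δ) * profile p q s xs y + r * profileDrift p q s xs y)) := by
    rw [← intervalIntegral.integral_const_mul]
    refine intervalIntegral.integral_eq_sub_of_hasDerivAt_of_le hk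
      (f := fun k => A * (k ^ α * ((lam + δ) * profile p q s xs k +
        r * profileDrift p q s xs k))) ?_ (fun u hu => ?_) ((hint y k).const_mul _)
    · have hsub : Set.Icc y k ⊆ Set.Ici xs := fun u hu => hy.trans hu.1
      have h1 := (continuousOn_profile (p := p) (q := q) hxs hs h).mono hsub
      have h2 := (continuousOn_profileDrift (p := p) (q := q) hxs hs h).mono hsub
      have h3 : ContinuousOn (fun u : ℝ => u ^ α) (Set.Icc y k) :=
        continuousOn_id.rpow_const fun u _ => Or.inr hα.le
      fun_prop
    · refine ((hasDerivAt_rpow_mul_profile hxs hs h hp hq hsp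
        (hy.trans_lt hu.1)).const_mul A).congr_deriv ?_
      rw [candidate_of_ge hu.1.le]
      ring
  have hnear : ∫ u in (0 : ℝ)..y, u ^ (α - 1) * candidate p q s xs κ A y u =
      y ^ α * (κ * (y / (α * (α + 1))) + A * profile p q s xs y / α) := by
    have : ∫ u in (0 : ℝ)..y, u ^ (α - 1) * candidate p q s xs κ A y u =
        ∫ u in (0 : ℝ)..y, ((κ * y + A * profile p q s xs y) * u ^ (α - 1) - κ * u ^ α) := by
      refine intervalIntegral.integral_congr_ae (Eventually.of_forall fun u hu => ?_)
      rw [Set.uIoc_of_le hy0.le] at hu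
      rw [candidate_of_le hu.2, Real.rpow_sub_one hu.1.ne']
      have := hu.1.ne'
      field_simp
      ring
    rw [this, intervalIntegral.integral_sub
      ((intervalIntegral.intervalIntegrable_rpow' (by linarith)).const_mul _)
      ((intervalIntegral.intervalIntegrable_rpow' (by linarith)).const_mul _),
      intervalIntegral.integral_const_mul, intervalIntegral.integral_const_mul,
      integral_rpow (Or.inl (by linarith)), integral_rpow (Or.inl (by linarith)),
      Real.zero_rpow (by linarith), Real.zero_rpow (by linarith), sub_add_cancel,
      Real.rpow_add_one hy0.ne']
    field_simp
    ring
  have key : α * (lam * ∫ u in (0 : ℝ)..y, u ^ (α - 1) * candidate p q s xs κ A y u) =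
      A * (y ^ α * ((lam + δ) * profile p q s xs y + r * profileDrift p q s xs y)) := by
    rw [hnear]
    have : κ * (y / (α * (α + 1))) * lam * α = κ * (lam * y / (α + 1)) := by field_simp
    have h2 : A * profile p q s xs y / α * α = A * profile p q s xs y := by field_simp
    linear_combination y ^ α * this + y ^ α * lam * h2 - y ^ α * hA
  linear_combination hfar + key

/-- The candidate reproduces itself in expectation over one waiting time and one loss. -/
lemma integral_discounted_candidate (hr : 0 < r) (hlam : 0 < lam) (hδ : 0 < δ) (hxs : 0 < xs)
    (hp0 : 0 < p) (hs : 0 < s) (h : 0 < s - p - q)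
    (hp : r * p ^ 2 + (δ + lam - α * r) * p - α * δ = 0) (hq : q = p - α + 1)
    (hsp : r * (s - 1) = 2 * r * p + (δ + lam - α * r)) (hα : 0 < α) (hy : xs ≤ y)
    (hA : A * (δ * profile p q s xs y + r * profileDrift p q s xs y) =
      κ * (lam * y / (α + 1))) {k : ℝ} (hk : y ≤ k) :
    ∫ t, ∫ z, Real.exp (-δ * t) * candidate p q s xs κ A y (flow r xs t k * z)
      ∂betaMeasure α 1 ∂expMeasure lam = candidate p q s xs κ A y k := by
  have hprob := isProbabilityMeasureBeta hα one_pos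
  have hxk := hy.trans hk
  obtain ⟨M, hM⟩ := exists_abs_candidate_le (q := q) (κ := κ) (A := A) hxs hp0 hs h hy
  obtain ⟨K, hK⟩ := exists_abs_profile_le (q := q) hxs hp0 hs h
  have hpf := (continuousOn_profile (p := p) (q := q) hxs hs h).comp_continuous
    (continuous_flow (r := r) (xs := xs) k) (le_flow_of_le hxk)
  have hdf := (continuousOn_profileDrift (p := p) (q := q) hxs hs h).comp_continuous
    (continuous_flow (r := r) (xs := xs) k) (le_flow_of_le hxk)
  -- An explicit primitive in the waiting time: the integral over `(0, ∞)` is then `-f 0`, the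
  -- candidate at `k`.
  set f : ℝ → ℝ := fun t =>
    -(Real.exp (-((lam + δ) * t)) * (A * profile p q s xs (flow r xs t k))) with hf
  set f' : ℝ → ℝ := fun t => Real.exp (-((lam + δ) * t)) *
    (A * ((lam + δ) * profile p q s xs (flow r xs t k) +
      r * profileDrift p q s xs (flow r xs t k))) with hf'
  have hderiv : ∀ t, HasDerivAt f (f' t) t := fun t => by
    have := ((((hasDerivAt_id t).const_mul (lam + δ)).neg.exp).mul
      ((hasDerivAt_profile_flow (r := r) hxs hs h hxk t).const_mul A)).neg
    refine this.congr_deriv ?_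
    simp only [hf', Pi.neg_apply, id]
    ring
  have hcongr : ∀ t ∈ Set.Ioi (0 : ℝ), lam * Real.exp (-(lam * t)) *
      ∫ z, Real.exp (-δ * t) * candidate p q s xs κ A y (flow r xs t k * z) ∂betaMeasure α 1 =
      f' t := fun t ht => by
    simp only [hf']
    rw [← mul_integral_candidate hxs hs h hp hq hsp hα hy hA
      (hk.trans (le_flow hr (le_of_lt ht))), integral_const_mul,
      show -((lam + δ) * t) = -(lam * t) + -δ * t by ring, Real.exp_add]
    ring
  have hexp : IntegrableOn (fun t => Real.exp (-(lam + δ) * t)) (Set.Ioi 0) :=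
    exp_neg_integrableOn_Ioi 0 (by positivity)
  have hint : IntegrableOn f' (Set.Ioi 0) := by
    refine Integrable.mono' (hexp.const_mul (lam * M)) ?_ ?_
    · have : Continuous f' := by
        simp only [Function.comp_def] at hpf hdf
        fun_prop
      exact this.aestronglyMeasurable
    · refine (ae_restrict_iff' measurableSet_Ioi).2 (Eventually.of_forall fun t ht => ?_)
      have hkt := hk.trans (le_flow (xs := xs) hr (le_of_lt ht))
      simp only [hf']
      rw [← mul_integral_candidate hxs hs h hp hq hsp hα hy hA hkt, norm_mul, norm_mul,
        Real.norm_of_nonneg (Real.exp_pos _).le, Real.norm_of_nonneg hlam.le, mul_comm,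
        neg_mul]
      have := norm_integral_le_of_norm_le_const (μ := betaMeasure α 1) (C := M)
        (f := fun z => candidate p q s xs κ A y (flow r xs t k * z)) (by
          filter_upwards [ae_mem_Ioo_betaMeasure α 1] with z hz
          exact hM _ (mul_nonneg ((hxs.trans_le hy).le.trans hkt) hz.1.le))
      simp only [probReal_univ, mul_one] at this
      gcongr
  have hlim : Tendsto f atTop (𝓝 0) := by
    have he : Tendsto (fun t => |A| * K * Real.exp (-((lam + δ) * t))) atTop (𝓝 0) := by
      have := (Real.tendsto_exp_neg_atTop_nhds_zero.comp
        (tendsto_id.const_mul_atTop (by positivity : 0 < lam + δ))).const_mul (|A| * K)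
      simpa [Function.comp_def] using this
    refine squeeze_zero_norm (fun t => ?_) he
    simp only [hf, norm_neg, norm_mul, Real.norm_eq_abs, abs_of_pos (Real.exp_pos _)]
    rw [mul_comm]
    gcongr
    exact hK _ (le_flow_of_le hxk t)
  rw [integral_expMeasure hlam, setIntegral_congr_fun measurableSet_Ioi hcongr,
    integral_Ioi_of_hasDerivAt_of_tendsto (hderiv 0).continuousAt.continuousWithinAt
      (fun t _ => hderiv t) hint hlim, candidate_of_ge hk]
  simp [hf, flow_zero]

lemma integral_exp_neg_expMeasure (hlam : 0 < lam) (hδ : 0 < δ) :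
    ∫ t, Real.exp (-δ * t) ∂expMeasure lam = lam / (lam + δ) := by
  rw [integral_expMeasure hlam]
  simp_rw [mul_assoc]
  rw [integral_const_mul]
  have : ∀ t : ℝ, Real.exp (-(lam * t)) * Real.exp (-δ * t) = Real.exp (-(lam + δ) * t) :=
    fun t => by rw [← Real.exp_add]; ring_nf
  simp_rw [this]
  rw [integral_exp_mul_Ioi (by linarith)]
  rw [mul_zero, Real.exp_zero, neg_div_neg_eq, mul_one_div]

end Candidate

/-! ### Rearranging independent families. -/

section Independence

variable {Ω : Type*} [MeasurableSpace Ω] {P : Measure Ω}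

/-- If `A`, `B` are independent, `C`, `D` are independent, and the pairs `(A, B)`, `(C, D)` are
independent, then so are the pairs `(A, C)`, `(B, D)`. -/
lemma indepFun_prodMk_prodMk_swap [IsProbabilityMeasure P] {E₁ E₂ E₃ E₄ : Type*} [MeasurableSpace E₁]
    [MeasurableSpace E₂] [MeasurableSpace E₃] [MeasurableSpace E₄] {A : Ω → E₁} {B : Ω → E₂}
    {C : Ω → E₃} {D : Ω → E₄} (hA : Measurable A) (hB : Measurable B) (hC : Measurable C)
    (hD : Measurable D) (hAB : IndepFun A B P) (hCD : IndepFun C D P)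
    (h : IndepFun (fun ω => (A ω, B ω)) (fun ω => (C ω, D ω)) P) :
    IndepFun (fun ω => (A ω, C ω)) (fun ω => (B ω, D ω)) P := by
  have hAC : IndepFun A C P := h.comp measurable_fst measurable_fst
  have hBD : IndepFun B D P := h.comp measurable_snd measurable_snd
  -- Measurable rectangles form a generating π-system, so a product formula for four events is
  -- enough.
  refine IndepSets.indep (hA.prodMk hC).comap_le (hB.prodMk hD).comap_le
    (isPiSystem_prod.comap fun ω => (A ω, C ω)) (isPiSystem_prod.comap fun ω => (B ω, D ω))
    (by rw [← generateFrom_prod, MeasurableSpace.comap_generateFrom]; rfl)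
    (by rw [← generateFrom_prod, MeasurableSpace.comap_generateFrom]; rfl) ?_
  rw [IndepSets_iff]
  rintro _ _ ⟨_, ⟨a, ha, c, hc, rfl⟩, rfl⟩ ⟨_, ⟨b, hb, d, hd, rfl⟩, rfl⟩
  simp only [Set.mem_ofPred_eq] at ha hb hc hd
  have e := h.measure_inter_preimage_eq_mul (a ×ˢ b) (c ×ˢ d) (ha.prod hb) (hc.prod hd)
  have e1 := hAB.measure_inter_preimage_eq_mul a b ha hb
  have e2 := hCD.measure_inter_preimage_eq_mul c d hc hd
  have e3 := hAC.measure_inter_preimage_eq_mul a c ha hc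
  have e4 := hBD.measure_inter_preimage_eq_mul b d hb hd
  simp only [Set.mk_preimage_prod] at e ⊢
  rw [e1, e2] at e
  rw [e3, e4, Set.inter_inter_inter_comm, e]
  ring

lemma indepFun_range_self {f : ℕ → Ω → ℝ} (h : iIndepFun f P) (hf : ∀ n, Measurable (f n))
    (n : ℕ) : IndepFun (fun ω (i : Finset.range n) => f i ω) (f n) P := by
  have hdisj : Disjoint (Finset.range n) {n} := by simp
  have hn : n ∈ ({n} : Finset ℕ) := by simp
  exact (h.indepFun_finset _ _ hdisj hf).comp measurable_id
    (measurable_pi_apply (⟨n, hn⟩ : ({n} : Finset ℕ)))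

end Independence

/-! ### The loss model: one-step transition, telescoping and the value. -/

section LossModel

variable {Ω : Type*} [MeasurableSpace Ω] {P : Measure Ω} {lam : ℝ} {G : Measure ℝ}
  {τ Z : ℕ → Ω → ℝ} {r xs y x : ℝ}

lemma IsLossModel.measurable_wait (hm : IsLossModel P lam G τ Z) (n : ℕ) :
    Measurable fun ω => τ (n + 1) ω - τ n ω :=
  (hm.measurable_time _).sub (hm.measurable_time _)

lemma IsLossModel.measurable_capitalBefore (hm : IsLossModel P lam G τ Z) (n : ℕ) :
    Measurable (capitalBefore r xs y x τ Z n) := by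
  induction n with
  | zero => exact measurable_const
  | succ n ih =>
    exact (measurable_flow.comp ((hm.measurable_wait n).prodMk
      (ih.max measurable_const))).mul (hm.measurable_proportion n)

lemma IsLossModel.measurable_transfer (hm : IsLossModel P lam G τ Z) (n : ℕ) :
    Measurable (transfer r xs y x τ Z n) :=
  (measurable_const.sub (hm.measurable_capitalBefore n)).max measurable_const

lemma IsLossModel.ae_nonneg (hm : IsLossModel P lam G τ Z) (hG : ∀ᵐ z ∂G, 0 ≤ z) :
    ∀ᵐ ω ∂P, ∀ n, 0 ≤ τ (n + 1) ω - τ n ω ∧ 0 ≤ Z n ω := by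
  refine ae_all_iff.2 fun n => ?_
  have h1 := ae_nonneg_expMeasure lam
  rw [← hm.law_wait n] at h1
  rw [← hm.law_proportion n] at hG
  exact (ae_of_ae_map (hm.measurable_wait n).aemeasurable h1).and
    (ae_of_ae_map (hm.measurable_proportion n).aemeasurable hG)

lemma IsLossModel.ae_time_nonneg (hm : IsLossModel P lam G τ Z) (hG : ∀ᵐ z ∂G, 0 ≤ z) :
    ∀ᵐ ω ∂P, ∀ n, 0 ≤ τ n ω := by
  filter_upwards [hm.ae_nonneg hG] with ω hω n
  induction n with
  | zero => exact (hm.time_zero ω).ge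
  | succ n ih => linarith [(hω n).1]

lemma IsLossModel.ae_capitalBefore_nonneg (hm : IsLossModel P lam G τ Z)
    (hG : ∀ᵐ z ∂G, 0 ≤ z) (hr : 0 < r) (hy : 0 ≤ y) (hx : 0 ≤ x) :
    ∀ᵐ ω ∂P, ∀ n, 0 ≤ capitalBefore r xs y x τ Z n ω := by
  filter_upwards [hm.ae_nonneg hG] with ω hω n
  cases n with
  | zero => exact hx
  | succ n =>
    exact mul_nonneg ((hy.trans (le_max_right _ _)).trans (le_flow hr (hω n).1)) (hω n).2

/-- The state just before the `n`-th transfer is a function of the first `n` waiting times and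
proportions. -/
lemma IsLossModel.exists_state_eq (hm : IsLossModel P lam G τ Z) (n : ℕ) :
    ∃ φ : (Finset.range n → ℝ) × (Finset.range n → ℝ) → ℝ × ℝ, Measurable φ ∧
      ∀ ω, (capitalBefore r xs y x τ Z n ω, τ n ω) =
        φ (fun i => τ (i + 1) ω - τ i ω, fun i => Z i ω) := by
  induction n with
  | zero => exact ⟨fun _ => (x, 0), measurable_const, fun ω => by simp [capitalBefore, hm.time_zero]⟩
  | succ n ih =>
    obtain ⟨φ, hφ, h⟩ := ih
    have hsub : Finset.range n ⊆ Finset.range (n + 1) := Finset.range_subset_range.2 n.le_succ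
    let i₀ : Finset.range (n + 1) := ⟨n, Finset.self_mem_range_succ n⟩
    let ψ : (Finset.range (n + 1) → ℝ) × (Finset.range (n + 1) → ℝ) → ℝ × ℝ := fun v =>
      φ (Finset.restrict₂ (π := fun _ => ℝ) hsub v.1, Finset.restrict₂ (π := fun _ => ℝ) hsub v.2)
    have hψ : Measurable ψ := hφ.comp
      (((Finset.measurable_restrict₂ (X := fun _ => ℝ) hsub).comp measurable_fst).prodMk
        ((Finset.measurable_restrict₂ (X := fun _ => ℝ) hsub).comp measurable_snd))
    have h1 : Measurable fun v : (Finset.range (n + 1) → ℝ) × (Finset.range (n + 1) → ℝ) =>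
      v.1 i₀ := (measurable_pi_apply i₀).comp measurable_fst
    have h2 : Measurable fun v : (Finset.range (n + 1) → ℝ) × (Finset.range (n + 1) → ℝ) =>
      v.2 i₀ := (measurable_pi_apply i₀).comp measurable_snd
    refine ⟨fun v => (flow r xs (v.1 i₀) (max (ψ v).1 y) * v.2 i₀, (ψ v).2 + v.1 i₀),
      ((measurable_flow.comp (h1.prodMk (hψ.fst.max measurable_const))).mul h2).prodMk
        (hψ.snd.add h1), fun ω => ?_⟩
    have e : ψ (fun i => τ (i + 1) ω - τ i ω, fun i => Z i ω) =
      (capitalBefore r xs y x τ Z n ω, τ n ω) := (h ω).symm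
    simp only [e]
    simp [capitalBefore, i₀]

lemma IsLossModel.indepFun_wait_proportion (hm : IsLossModel P lam G τ Z) :
    IndepFun (fun ω (n : ℕ) => τ (n + 1) ω - τ n ω) (fun ω n => Z n ω) P :=
  hm.indep_time_proportion.comp
    (φ := fun (t : ℕ → ℝ) (n : ℕ) => t (n + 1) - t n) (ψ := id)
    (measurable_pi_lambda _ fun n =>
      (measurable_pi_apply (n + 1)).sub (measurable_pi_apply n)) measurable_id

variable [IsProbabilityMeasure P]

lemma IsLossModel.map_wait_proportion (hm : IsLossModel P lam G τ Z) (n : ℕ) :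
    P.map (fun ω => (τ (n + 1) ω - τ n ω, Z n ω)) = (expMeasure lam).prod G := by
  have h : IndepFun (fun ω => τ (n + 1) ω - τ n ω) (Z n) P :=
    hm.indepFun_wait_proportion.comp (measurable_pi_apply n) (measurable_pi_apply n)
  rw [h.map_prod_eq_prod_map_map (hm.measurable_wait n).aemeasurable
    (hm.measurable_proportion n).aemeasurable, hm.law_wait, hm.law_proportion]

/-- Past waits and proportions are each independent of their next term, and waits are independent of
proportions; swapping the pairs separates past from next step. The state depends on the past only.
-/
lemma IsLossModel.indepFun_state (hm : IsLossModel P lam G τ Z) (n : ℕ) :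
    IndepFun (fun ω => (capitalBefore r xs y x τ Z n ω, τ n ω))
      (fun ω => (τ (n + 1) ω - τ n ω, Z n ω)) P := by
  obtain ⟨φ, hφ, h⟩ := hm.exists_state_eq (r := r) (xs := xs) (y := y) (x := x) n
  have hpast : ∀ {f : ℕ → Ω → ℝ}, (∀ n, Measurable (f n)) →
      Measurable fun ω (i : Finset.range n) => f i ω :=
    fun hf => measurable_pi_lambda _ fun i => hf i
  have key := indepFun_prodMk_prodMk_swap (P := P) (hpast hm.measurable_wait)
    (hm.measurable_wait n) (hpast hm.measurable_proportion) (hm.measurable_proportion n)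
    (indepFun_range_self hm.indep_wait hm.measurable_wait n)
    (indepFun_range_self hm.indep_proportion hm.measurable_proportion n)
    (hm.indepFun_wait_proportion.comp
      (φ := fun w : ℕ → ℝ => ((fun i : Finset.range n => w i), w n))
      (ψ := fun w : ℕ → ℝ => ((fun i : Finset.range n => w i), w n))
      ((measurable_pi_lambda _ fun i => measurable_pi_apply _).prodMk (measurable_pi_apply n))
      ((measurable_pi_lambda _ fun i => measurable_pi_apply _).prodMk (measurable_pi_apply n)))
  rw [funext h]
  exact key.comp hφ measurable_id

lemma IsLossModel.integrable_discount (hm : IsLossModel P lam G τ Z) (hG : ∀ᵐ z ∂G, 0 ≤ z)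
    {δ : ℝ} (hδ : 0 < δ) (n : ℕ) : Integrable (fun ω => Real.exp (-δ * τ n ω)) P := by
  refine Integrable.of_bound
    (((hm.measurable_time n).const_mul (-δ)).exp.aestronglyMeasurable) 1 ?_
  filter_upwards [hm.ae_time_nonneg hG] with ω hω
  rw [Real.norm_of_nonneg (Real.exp_pos _).le, Real.exp_le_one_iff]
  nlinarith [hω n]

lemma IsLossModel.integral_discount (hm : IsLossModel P lam G τ Z) (hlam : 0 < lam)
    {δ : ℝ} (hδ : 0 < δ) (n : ℕ) :
    ∫ ω, Real.exp (-δ * τ n ω) ∂P = (lam / (lam + δ)) ^ n := by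
  induction n with
  | zero => simp [hm.time_zero]
  | succ n ih =>
    have hexp : Measurable fun t : ℝ => Real.exp (-δ * t) := by fun_prop
    have hind : IndepFun (fun ω => Real.exp (-δ * τ n ω))
        (fun ω => Real.exp (-δ * (τ (n + 1) ω - τ n ω))) P :=
      -- Only the time component of the state is used, so the capital parameters are arbitrary.
      (hm.indepFun_state (r := 0) (xs := 0) (y := 0) (x := 0) n).comp
        (hexp.comp measurable_snd) (hexp.comp measurable_fst)
    have hw : ∫ ω, Real.exp (-δ * (τ (n + 1) ω - τ n ω)) ∂P = lam / (lam + δ) := by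
      rw [← integral_exp_neg_expMeasure hlam hδ, ← hm.law_wait n,
        integral_map (hm.measurable_wait n).aemeasurable hexp.aestronglyMeasurable]
    rw [pow_succ, ← ih, ← hw]
    refine Eq.trans ?_ (hind.integral_mul_eq_mul_integral
      (hexp.comp (hm.measurable_time n)).aestronglyMeasurable
      (hexp.comp (hm.measurable_wait n)).aestronglyMeasurable)
    refine integral_congr_ae (Eventually.of_forall fun ω => ?_)
    simp only [Pi.mul_apply]
    rw [← Real.exp_add]
    ring_nf

lemma IsLossModel.integrable_discount_mul (hm : IsLossModel P lam G τ Z)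
    (hG : ∀ᵐ z ∂G, 0 ≤ z) {δ : ℝ} (hδ : 0 < δ) (n : ℕ) {f : Ω → ℝ} (hf : Measurable f) {M : ℝ}
    (hM : ∀ᵐ ω ∂P, |f ω| ≤ M) : Integrable (fun ω => Real.exp (-δ * τ n ω) * f ω) P := by
  refine Integrable.mono' ((hm.integrable_discount hG hδ n).mul_const M)
    (((hm.measurable_time n).const_mul (-δ)).exp.mul hf).aestronglyMeasurable ?_
  filter_upwards [hM] with ω hω
  rw [norm_mul, Real.norm_of_nonneg (Real.exp_pos _).le]
  exact mul_le_mul_of_nonneg_left hω (Real.exp_pos _).le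

variable {h : ℝ → ℝ} {M δ κ : ℝ}

/-- The Markov step: by independence the joint law is a product, and Fubini evaluates the inner
integral over the next wait and proportion by `hfix`. It applies because capital after a transfer is
at least `y`. -/
lemma IsLossModel.integral_step (hm : IsLossModel P lam G τ Z) (hG : ∀ᵐ z ∂G, 0 ≤ z)
    [IsProbabilityMeasure G] (hlam : 0 < lam) (hδ : 0 < δ) (hr : 0 < r) (hy : 0 ≤ y)
    (hx : 0 ≤ x) (hh : Measurable h) (hM : ∀ k, 0 ≤ k → |h k| ≤ M)
    (hfix : ∀ k, y ≤ k → ∫ t, ∫ z, Real.exp (-δ * t) * h (flow r xs t k * z) ∂G ∂expMeasure lam =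
      h k) (n : ℕ) :
    ∫ ω, Real.exp (-δ * τ (n + 1) ω) * h (capitalBefore r xs y x τ Z (n + 1) ω) ∂P =
      ∫ ω, Real.exp (-δ * τ n ω) * h (max (capitalBefore r xs y x τ Z n ω) y) ∂P := by
  have hprob := isProbabilityMeasure_expMeasure hlam
  set U : Ω → ℝ × ℝ := fun ω => (capitalBefore r xs y x τ Z n ω, τ n ω)
  set V : Ω → ℝ × ℝ := fun ω => (τ (n + 1) ω - τ n ω, Z n ω)
  set Ψ : (ℝ × ℝ) × (ℝ × ℝ) → ℝ := fun v => Real.exp (-δ * v.1.2) *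
    (Real.exp (-δ * v.2.1) * h (flow r xs v.2.1 (max v.1.1 y) * v.2.2)) with hΨdef
  have hU : Measurable U := (hm.measurable_capitalBefore n).prodMk (hm.measurable_time n)
  have hV : Measurable V := (hm.measurable_wait n).prodMk (hm.measurable_proportion n)
  have hΨ : Measurable Ψ := by
    have hflow : Measurable fun v : (ℝ × ℝ) × (ℝ × ℝ) => flow r xs v.2.1 (max v.1.1 y) :=
      measurable_flow.comp
        (by fun_prop : Measurable fun v : (ℝ × ℝ) × (ℝ × ℝ) => (v.2.1, max v.1.1 y))
    exact (by fun_prop : Measurable fun v : (ℝ × ℝ) × (ℝ × ℝ) => Real.exp (-δ * v.1.2)).mul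
      ((by fun_prop : Measurable fun v : (ℝ × ℝ) × (ℝ × ℝ) => Real.exp (-δ * v.2.1)).mul
        (hh.comp (hflow.mul (by fun_prop))))
  have hcomp : ∀ ω, Real.exp (-δ * τ (n + 1) ω) * h (capitalBefore r xs y x τ Z (n + 1) ω) =
      Ψ (U ω, V ω) := fun ω => by
    simp only [hΨdef, U, V, capitalBefore]
    rw [← mul_assoc, ← Real.exp_add]
    ring_nf
  have hint : Integrable (fun ω => Ψ (U ω, V ω)) P := by
    simp_rw [← hcomp]
    refine hm.integrable_discount_mul hG hδ (n + 1)
      (hh.comp (hm.measurable_capitalBefore (n + 1))) (M := M) ?_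
    filter_upwards [hm.ae_capitalBefore_nonneg (xs := xs) hG hr hy hx] with ω hω
    exact hM _ (hω _)
  have hmap : P.map (fun ω => (U ω, V ω)) = (P.map U).prod ((expMeasure lam).prod G) := by
    rw [(hm.indepFun_state n).map_prod_eq_prod_map_map hU.aemeasurable hV.aemeasurable,
      hm.map_wait_proportion]
  have hUV : AEMeasurable (fun ω => (U ω, V ω)) P := (hU.prodMk hV).aemeasurable
  have hint' : Integrable Ψ ((P.map U).prod ((expMeasure lam).prod G)) := by
    rw [← hmap, integrable_map_measure hΨ.aestronglyMeasurable hUV]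
    exact hint
  have hinner : ∀ᵐ u ∂P.map U, ∫ v, Ψ (u, v) ∂(expMeasure lam).prod G =
      Real.exp (-δ * u.2) * h (max u.1 y) := by
    filter_upwards [hint'.prod_right_ae] with u hu
    rw [integral_prod _ hu, ← hfix _ (le_max_right u.1 y), ← integral_const_mul]
    refine integral_congr_ae (Eventually.of_forall fun t => ?_)
    simp only [hΨdef]
    rw [integral_const_mul]
  simp_rw [hcomp]
  rw [← integral_map hUV hΨ.aestronglyMeasurable, hmap, integral_prod _ hint',
    integral_congr_ae hinner, integral_map hU.aemeasurable]
  exact ((by fun_prop : Measurable fun u : ℝ × ℝ => Real.exp (-δ * u.2)).mul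
    (hh.comp (by fun_prop))).aestronglyMeasurable

lemma IsLossModel.integrable_discount_transfer (hm : IsLossModel P lam G τ Z)
    (hG : ∀ᵐ z ∂G, 0 ≤ z) (hδ : 0 < δ) (hr : 0 < r) (hy : 0 ≤ y) (hx : 0 ≤ x) (n : ℕ) :
    Integrable (fun ω => Real.exp (-δ * τ n ω) * transfer r xs y x τ Z n ω) P := by
  refine hm.integrable_discount_mul hG hδ n (hm.measurable_transfer n) (M := y) ?_
  filter_upwards [hm.ae_capitalBefore_nonneg (xs := xs) hG hr hy hx] with ω hω
  rw [transfer, abs_of_nonneg (le_max_right _ _)]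
  exact max_le (by linarith [hω n]) hy

/-- A bounded function which solves the equation of the model is `κ` times the value function. -/
lemma IsLossModel.tendsto_sum_discount_transfer (hm : IsLossModel P lam G τ Z)
    (hG : ∀ᵐ z ∂G, 0 ≤ z) [IsProbabilityMeasure G] (hlam : 0 < lam) (hδ : 0 < δ) (hr : 0 < r)
    (hy : 0 ≤ y) (hx : 0 ≤ x) (hh : Measurable h) (hM : ∀ k, 0 ≤ k → |h k| ≤ M)
    (hadd : ∀ k, h k = κ * max (y - k) 0 + h (max k y))
    (hfix : ∀ k, y ≤ k → ∫ t, ∫ z, Real.exp (-δ * t) * h (flow r xs t k * z) ∂G ∂expMeasure lam =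
      h k) :
    Tendsto (fun N => ∑ n ∈ Finset.range N,
      κ * ∫ ω, Real.exp (-δ * τ n ω) * transfer r xs y x τ Z n ω ∂P) atTop (𝓝 (h x)) := by
  set m : ℕ → ℝ := fun n =>
    ∫ ω, Real.exp (-δ * τ n ω) * h (capitalBefore r xs y x τ Z n ω) ∂P with hmdef
  have hstep : ∀ n, κ * ∫ ω, Real.exp (-δ * τ n ω) * transfer r xs y x τ Z n ω ∂P =
      m n - m (n + 1) := fun n => by
    simp only [hmdef]
    rw [hm.integral_step hG hlam hδ hr hy hx hh hM hfix n, ← integral_const_mul,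
      ← integral_sub]
    · refine integral_congr_ae (Eventually.of_forall fun ω => ?_)
      simp only [transfer]
      rw [hadd (capitalBefore r xs y x τ Z n ω)]
      ring
    · refine hm.integrable_discount_mul hG hδ n
        (hh.comp (hm.measurable_capitalBefore n)) (M := M) ?_
      filter_upwards [hm.ae_capitalBefore_nonneg (xs := xs) hG hr hy hx] with ω hω
      exact hM _ (hω _)
    · exact hm.integrable_discount_mul hG hδ n
        (hh.comp ((hm.measurable_capitalBefore n).max measurable_const)) (M := M)
        (Eventually.of_forall fun ω => hM _ (hy.trans (le_max_right _ _)))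
  have hm0 : m 0 = h x := by simp [hmdef, capitalBefore, hm.time_zero]
  -- Boundedness of `h` enters here: `m n` is dominated by `M` times the expected discount at the
  -- `n`-th event.
  have hlim : Tendsto m atTop (𝓝 0) := by
    have hρ := (tendsto_pow_atTop_nhds_zero_of_lt_one (r := lam / (lam + δ)) (by positivity)
      ((div_lt_one (by positivity)).2 (by linarith))).mul_const M
    rw [zero_mul] at hρ
    refine squeeze_zero_norm (fun n => ?_) hρ
    rw [← hm.integral_discount hlam hδ n, ← integral_mul_const]
    refine norm_integral_le_of_norm_le ((hm.integrable_discount hG hδ n).mul_const M) ?_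
    filter_upwards [hm.ae_capitalBefore_nonneg (xs := xs) hG hr hy hx] with ω hω
    rw [norm_mul, Real.norm_of_nonneg (Real.exp_pos _).le]
    exact mul_le_mul_of_nonneg_left (hM _ (hω n)) (Real.exp_pos _).le
  simp_rw [hstep, Finset.sum_range_sub', hm0]
  simpa using hlim.const_sub (h x)

lemma IsLossModel.thresholdValue_eq_tsum (hm : IsLossModel P lam G τ Z)
    (hG : ∀ᵐ z ∂G, 0 ≤ z) (hδ : 0 < δ) (hr : 0 < r) (hy : 0 ≤ y) (hx : 0 ≤ x) :
    thresholdValue P r xs δ τ Z y x = ∑' n, ENNReal.ofReal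
      (∫ ω, Real.exp (-δ * τ n ω) * transfer r xs y x τ Z n ω ∂P) := by
  have hexp : Measurable fun t : ℝ => ENNReal.ofReal (Real.exp (-δ * t)) := by fun_prop
  have hnn : ∀ n ω, 0 ≤ Real.exp (-δ * τ n ω) * transfer r xs y x τ Z n ω := fun n ω =>
    mul_nonneg (Real.exp_pos _).le (le_max_right _ _)
  have hmeas : ∀ n, AEMeasurable (fun ω =>
      ENNReal.ofReal (Real.exp (-δ * τ n ω) * transfer r xs y x τ Z n ω)) P := fun n =>
    ((((hm.measurable_time n).const_mul (-δ)).exp.mul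
      (hm.measurable_transfer n)).ennreal_ofReal).aemeasurable
  have hpath : ∀ᵐ ω ∂P, ∫⁻ t in Set.Ici 0, ENNReal.ofReal (Real.exp (-δ * t))
      ∂(thresholdTransfers r xs y x τ Z ω) =
      ∑' n, ENNReal.ofReal (Real.exp (-δ * τ n ω) * transfer r xs y x τ Z n ω) := by
    filter_upwards [hm.ae_time_nonneg hG] with ω hω
    rw [← lintegral_indicator measurableSet_Ici, thresholdTransfers, lintegral_sum_measure]
    refine tsum_congr fun n => ?_
    rw [lintegral_smul_measure, lintegral_dirac' _ (hexp.indicator measurableSet_Ici),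
      Set.indicator_of_mem (Set.mem_Ici.2 (hω n)), smul_eq_mul, mul_comm,
      ENNReal.ofReal_mul (Real.exp_pos _).le]
  rw [thresholdValue, expectedCost, lintegral_congr_ae hpath, lintegral_tsum hmeas]
  refine tsum_congr fun n => ?_
  rw [ofReal_integral_eq_lintegral_ofReal
    (hm.integrable_discount_transfer hG hδ hr hy hx n) (Eventually.of_forall (hnn n))]

/-- The terms are nonnegative, so convergence of partial sums is summability. It also gives `0 ≤ h
x`, so `ENNReal.ofReal` truncates nothing. -/
lemma IsLossModel.thresholdValue_eq (hm : IsLossModel P lam G τ Z)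
    (hG : ∀ᵐ z ∂G, 0 ≤ z) [IsProbabilityMeasure G] (hlam : 0 < lam) (hδ : 0 < δ) (hr : 0 < r)
    (hy : 0 ≤ y) (hx : 0 ≤ x) (hh : Measurable h) (hM : ∀ k, 0 ≤ k → |h k| ≤ M)
    (hadd : ∀ k, h k = max (y - k) 0 + h (max k y))
    (hfix : ∀ k, y ≤ k → ∫ t, ∫ z, Real.exp (-δ * t) * h (flow r xs t k * z) ∂G ∂expMeasure lam =
      h k) :
    thresholdValue P r xs δ τ Z y x = ENNReal.ofReal (h x) := by
  have hlim := hm.tendsto_sum_discount_transfer hG hlam hδ hr hy hx hh hM (κ := 1)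
    (by simpa using hadd) hfix
  simp only [one_mul] at hlim
  have hnn : ∀ n, 0 ≤ ∫ ω, Real.exp (-δ * τ n ω) * transfer r xs y x τ Z n ω ∂P := fun n =>
    integral_nonneg fun ω => mul_nonneg (Real.exp_pos _).le (le_max_right _ _)
  have hsum := (hasSum_iff_tendsto_nat_of_nonneg hnn _).2 hlim
  rw [hm.thresholdValue_eq_tsum hG hδ hr hy hx, ← hsum.tsum_eq,
    ENNReal.ofReal_tsum_of_nonneg hnn hsum.summable]

end LossModel

/-! ### The constants as roots of the indicial equation. -/

section Parameters

variable {r lam δ α : ℝ}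

lemma paramB_root (hr : 0 < r) (hδ : 0 < δ) (hα : 0 < α) :
    r * paramB r lam δ α ^ 2 + (δ + lam - α * r) * paramB r lam δ α - α * δ = 0 := by
  have hsq := Real.sq_sqrt
    (by positivity : 0 ≤ (δ + lam - α * r) ^ 2 + 4 * r * α * δ)
  rw [paramB]
  generalize √((δ + lam - α * r) ^ 2 + 4 * r * α * δ) = R at hsq ⊢
  field_simp
  linear_combination hsq

lemma paramB_pos (hr : 0 < r) (hδ : 0 < δ) (hα : 0 < α) : 0 < paramB r lam δ α := by
  have h : |δ + lam - α * r| < √((δ + lam - α * r) ^ 2 + 4 * r * α * δ) := by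
    rw [← Real.sqrt_sq_eq_abs]
    exact Real.sqrt_lt_sqrt (sq_nonneg _) (lt_add_of_pos_right _ (by positivity))
  have := le_abs_self (δ + lam - α * r)
  exact div_pos (by linarith) (by positivity)

lemma mul_paramB_sub_paramA (hr : 0 < r) :
    r * (paramB r lam δ α - paramA r lam δ α) =
      2 * r * paramB r lam δ α + (δ + lam - α * r) := by
  rw [paramA, paramB]
  field_simp
  ring

lemma paramA_le_paramB (hr : 0 < r) : paramA r lam δ α ≤ paramB r lam δ α := by
  have := Real.sqrt_nonneg ((δ + lam - α * r) ^ 2 + 4 * r * α * δ)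
  rw [paramA, paramB]
  gcongr
  linarith

lemma paramA_add_paramB (hr : 0 < r) :
    paramA r lam δ α + paramB r lam δ α = α - (δ + lam) / r := by
  rw [paramA, paramB]
  field_simp
  ring

end Parameters

end SocialProtection

/-! ### Assembly: nonvanishing of the denominator and identification of the value. -/

theorem mainTheorem7 {Ω : Type*} [MeasurableSpace Ω] (P : Measure Ω) [IsProbabilityMeasure P]
    (r xs lam δ α : ℝ) (hr : 0 < r) (hxs : 0 < xs) (hlam : 0 < lam) (hδ : 0 < δ) (hα : 0 < α)
    (τ Z : ℕ → Ω → ℝ)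
    (hmodel : SocialProtection.IsLossModel P lam (betaMeasure α 1) τ Z)
    (a b c : ℝ) (ha : a = SocialProtection.paramA r lam δ α)
    (hb : b = SocialProtection.paramB r lam δ α) (hc : c = α)
    (y : ℝ) (hy : xs ≤ y) :
    (∀ x : ℝ, 0 ≤ x → x ≤ y →
      SocialProtection.thresholdValue P r xs δ τ Z y x =
        ENNReal.ofReal ((y - x) +
          ₂F₁ b (b - c + 1) (b - a + 1) (xs / y) * SocialProtection.coeffA r xs lam δ α y *
            (xs / y) ^ b)) ∧
    (∀ x : ℝ, y < x →
      SocialProtection.thresholdValue P r xs δ τ Z y x =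
        ENNReal.ofReal (₂F₁ b (b - c + 1) (b - a + 1) (xs / x) *
          SocialProtection.coeffA r xs lam δ α y * (xs / x) ^ b)) := by
  subst ha hb hc
  have hp := SocialProtection.paramB_root (lam := lam) hr hδ hα
  have hp0 := SocialProtection.paramB_pos (lam := lam) hr hδ hα
  have hsp := SocialProtection.mul_paramB_sub_paramA (lam := lam) (δ := δ) (α := c) hr
  have hab := SocialProtection.paramA_le_paramB (lam := lam) (δ := δ) (α := c) hr
  have hsum := SocialProtection.paramA_add_paramB (lam := lam) (δ := δ) (α := c) hr
  have hcoeff : SocialProtection.coeffA r xs lam δ c y = lam * y / (c + 1) /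
      (δ * SocialProtection.profile (SocialProtection.paramB r lam δ c)
        (SocialProtection.paramB r lam δ c - c + 1)
        (SocialProtection.paramB r lam δ c - SocialProtection.paramA r lam δ c + 1) xs y +
      r * SocialProtection.profileDrift (SocialProtection.paramB r lam δ c)
        (SocialProtection.paramB r lam δ c - c + 1)
        (SocialProtection.paramB r lam δ c - SocialProtection.paramA r lam δ c + 1) xs y) := by
    have hy0 := (hxs.trans_le hy).ne'
    rw [SocialProtection.coeffA, div_div, SocialProtection.profile, SocialProtection.profileDrift]
    congr 1
    field_simp
  generalize SocialProtection.coeffA r xs lam δ c y = A at hcoeff ⊢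
  generalize SocialProtection.paramB r lam δ c = b at *
  generalize SocialProtection.paramA r lam δ c = a at *
  have hs : 0 < b - a + 1 := by linarith
  have hspq : 0 < b - a + 1 - b - (b - c + 1) := by
    have : 0 < (δ + lam) / r := by positivity
    linarith
  rw [← add_sub_cancel_right (b - a) 1] at hsp
  have hy0 : 0 ≤ y := hxs.le.trans hy
  have hprob := isProbabilityMeasureBeta hα one_pos
  have hG : ∀ᵐ z ∂betaMeasure c 1, 0 ≤ z :=
    (SocialProtection.ae_mem_Ioo_betaMeasure c 1).mono fun z hz => hz.1.le
  have hne : δ * SocialProtection.profile b (b - c + 1) (b - a + 1) xs y +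
      r * SocialProtection.profileDrift b (b - c + 1) (b - a + 1) xs y ≠ 0 := by
    -- With a vanishing denominator, `κ = 0` and `A = 1` satisfy the matching condition at `y`; all
    -- partial sums are then `0`, which forces `profile` to vanish on `[y, ∞)`.
    intro h0
    obtain ⟨k, hk, hk0⟩ := SocialProtection.exists_profile_ne_zero hxs hs hspq y
    obtain ⟨M, hM⟩ := SocialProtection.exists_abs_candidate_le (κ := 0) (A := 1) hxs hp0 hs hspq hy
    have hlim := hmodel.tendsto_sum_discount_transfer hG hlam hδ hr hy0 (hy0.trans hk)
      (SocialProtection.continuous_candidate hxs hs hspq hy).measurable hM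
      SocialProtection.candidate_eq_add
      fun k hk => SocialProtection.integral_discounted_candidate hr hlam hδ hxs hp0 hs hspq hp rfl
        hsp hα hy (by rw [h0]; ring) hk
    simp only [zero_mul, Finset.sum_const_zero] at hlim
    have := tendsto_nhds_unique hlim tendsto_const_nhds
    rw [SocialProtection.candidate_of_ge hk, one_mul] at this
    exact hk0 this
  have hvalue : ∀ x, 0 ≤ x → SocialProtection.thresholdValue P r xs δ τ Z y x = ENNReal.ofReal
      (SocialProtection.candidate b (b - c + 1) (b - a + 1) xs 1 A y x) := fun x hx => by
    obtain ⟨M, hM⟩ := SocialProtection.exists_abs_candidate_le (κ := 1) (A := A) hxs hp0 hs hspq hy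
    refine hmodel.thresholdValue_eq hG hlam hδ hr hy0 hx
      (SocialProtection.continuous_candidate hxs hs hspq hy).measurable hM
      (fun k => by rw [← one_mul (max (y - k) 0)]; exact SocialProtection.candidate_eq_add k)
      fun k hk => SocialProtection.integral_discounted_candidate hr hlam hδ hxs hp0 hs hspq hp rfl
        hsp hα hy ?_ hk
    rw [hcoeff, div_mul_cancel₀ _ hne, one_mul]
  refine ⟨fun x hx hxy => ?_, fun x hxy => ?_⟩
  · rw [hvalue x hx, SocialProtection.candidate_of_le hxy, SocialProtection.profile, one_mul]
    congr 1
    ring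
  · rw [hvalue x (hy0.trans hxy.le), SocialProtection.candidate_of_ge hxy.le,
      SocialProtection.profile]
    congr 1
    ring
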